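/- Let $\mathfrak o$ be a complete discrete valuation ring with maximal ideal $\mathfrak p$ and finite residue field, let $\ell\in\mathbb N$ and $\mathfrak o_\ell=\mathfrak o/\mathfrak p^\ell$. Let $R$ be a finite (not necessarily commutative) $\mathfrak o_\ell$-algebra, let $M_1,\dots,M_k$ be finite indecomposable $R$-modules, and let $\mathcal C=\langle M_1,\dots,M_k\rangle$ be the full subcategory of the category of left $R$-modules consisting of the modules isomorphic to $\bigoplus_i M_i^{a_i}$ with $a_i\in\mathbb N$. Let $\mathcal C_{+1}=\mathrm{Fun}_{\mathfrak o_\ell}(\mathcal C,\mathfrak o_\ell\text{-}\mathrm{Mod})$ be the category of $\mathfrak o_\ell$-linear functors. For $F,G\in\mathcal C_{+1}$ write $G\preccurlyeq F$ if $G$ is isomorphic to a subquotient of $F$ (a quotient of a subfunctor of $F$), and $G\prec F$ if $G\preccurlyeq F$ and $G\not\cong F$. Let $K$ be an algebraically closed field of characteristic zero and let $M\in\mathcal C$. For $F\in\mathcal C_{+1}$ let $KF(M)$ be the $K$-vector space with basis $\{u_m\mid m\in F(M)\}$, on which $g\in\mathrm{Aut}_R(M)$ acts by $u_m\mapsto u_{F(g)(m)}$.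 An irreducible representation $V$ of $\mathrm{Aut}_R(M)$ over $K$ is called $F$-typical if $\mathrm{Hom}_{\mathrm{Aut}_R(M)}(KF(M),V)\neq 0$ and $\mathrm{Hom}_{\mathrm{Aut}_R(M)}(KG(M),V)=0$ for all $G\prec F$. 1. For every irreducible representation $V$ of $\mathrm{Aut}_R(M)$ over $K$ there is a functor $F\in\mathcal C_{+1}$, unique up to isomorphism, such that $V$ is $F$-typical; this $F$ takes values in finite modules, and $V$ is $G$-typical for every $G\cong F$. 2. An irreducible representation $V$ is $F$-typical if and only if $V$ is isomorphic to a subrepresentation of $KF(M)$ and is not isomorphic to a subrepresentation of $KG(M)$ for any $G\prec F$. 3. Let $\mathrm{Rep}(\mathrm{Aut}_R(M))$ be the category of finite-dimensional representations over $K$ and $\mathrm{Rep}(\mathrm{Aut}_R(M))_F$ its full subcategory of finite direct sums of $F$-typical irreducible representations. Then $$\mathrm{Rep}(\mathrm{Aut}_R(M))=\bigoplus_{F}\mathrm{Rep}(\mathrm{Aut}_R(M))_F,$$ where $F$ runs over the isomorphism classes of objects of $\mathcal C_{+1}$. That is, every finite-dimensional representation $W$ has a unique family of subrepresentations $W_F\in\mathrm{Rep}(\mathrm{Aut}_R(M))_F$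 with $W=\bigoplus_F W_F$, and there are no non-zero homomorphisms from an object of $\mathrm{Rep}(\mathrm{Aut}_R(M))_F$ to an object of $\mathrm{Rep}(\mathrm{Aut}_R(M))_G$ when $F\not\cong G$. -/

import Mathlib

open CategoryTheory

universe v u₁ u₂ w x y

noncomputable section

namespace FunctorMorphing

section Categories

variable (A : Type u₁) [CommRing A] {R : Type u₂} [Ring R] [Algebra A R]

/-- `X` is (isomorphic to) a module of the form `⨁ᵢ Mᵢ ^ aᵢ`, with `aᵢ ∈ ℕ`. -/
def IsSumOf {k : ℕ} (Ms : Fin k → ModuleCat.{v} R) : ObjectProperty (ModuleCat.{v} R) :=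
  fun X => ∃ a : Fin k → ℕ, Nonempty (X ≃ₗ[R] ((i : Fin k) → (Fin (a i) → Ms i)))

/-- The full subcategory `𝒞 = ⟨M₁, …, M_k⟩` of the category of left `R`-modules. -/
abbrev AddSpan {k : ℕ} (Ms : Fin k → ModuleCat.{v} R) := (IsSumOf Ms).FullSubcategory

open scoped ModuleCat.Algebra in
/-- A functor `𝒞 ⥤ A-Mod` is `A`-linear if it is additive and commutes with the action of `A`
on morphisms (`A` acts on morphisms of `R`-modules through `A → R`). -/
def IsLinearFunctor {k : ℕ} (Ms : Fin k → ModuleCat.{v} R) :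
    ObjectProperty (AddSpan Ms ⥤ ModuleCat.{v} A) :=
  fun F => F.Additive ∧ F.Linear A

/-- The category `𝒞₊₁` of `A`-linear functors from `𝒞` to `A`-modules, with natural
transformations as morphisms. -/
abbrev LinFun {k : ℕ} (Ms : Fin k → ModuleCat.{v} R) := (IsLinearFunctor A Ms).FullSubcategory

end Categories

section Order

variable {A : Type u₁} [CommRing A] {R : Type u₂} [Ring R] [Algebra A R]
  {k : ℕ} {Ms : Fin k → ModuleCat.{v} R}

/-- `F ≼ G`: the functor `F` is isomorphic to a subquotient of `G`, i.e. it is a quotient of a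
subfunctor `H` of `G`. -/
def IsSubquotient (F G : LinFun A Ms) : Prop :=
  ∃ (H : LinFun A Ms) (i : H ⟶ G) (p : H ⟶ F),
    (∀ X, Function.Injective (i.hom.app X)) ∧ (∀ X, Function.Surjective (p.hom.app X))

/-- `F ≺ G`: `F ≼ G` but `F` and `G` are not isomorphic. -/
def IsProperSubquotient (F G : LinFun A Ms) : Prop :=
  IsSubquotient F G ∧ ¬ Nonempty (F ≅ G)

/-- All values of `F` are finite modules. -/
def IsFiniteValued (F : LinFun A Ms) : Prop := ∀ X : AddSpan Ms, Finite (F.obj.obj X)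

/-- An isomorphism class of objects of `𝒞₊₁`. -/
abbrev IsoClass (A : Type u₁) [CommRing A] {R : Type u₂} [Ring R] [Algebra A R]
    {k : ℕ} (Ms : Fin k → ModuleCat.{v} R) :=
  Quotient (isIsomorphicSetoid (LinFun A Ms))

end Order

section Representations

variable {A : Type u₁} [CommRing A] {R : Type u₂} [Ring R] [Algebra A R]
  {k : ℕ} {Ms : Fin k → ModuleCat.{v} R}

/-- The group `Aut_R(M)`. -/
abbrev AutGroup (M : AddSpan Ms) := M.obj ≃ₗ[R] M.obj

/-- An automorphism of `M` as a morphism of `𝒞`. -/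
def autHom (M : AddSpan Ms) (g : AutGroup M) : M ⟶ M :=
  ObjectProperty.homMk (ModuleCat.ofHom (g : M.obj →ₗ[R] M.obj))

variable (K : Type w) [Field K]

/-- The permutation representation `KF(M)` of `Aut_R(M)`: the vector space with basis the set
`F(M)`, on which `g` acts by `u_m ↦ u_{F(g)(m)}`. -/
def permRep (F : LinFun A Ms) (M : AddSpan Ms) :
    Representation K (AutGroup M) (F.obj.obj M →₀ K) where
  toFun g := Finsupp.lmapDomain K K (F.obj.map (autHom M g))
  map_one' := by
    have h : autHom M 1 = 𝟙 M := rfl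
    rw [h, F.obj.map_id]
    exact Finsupp.lmapDomain_id K K
  map_mul' g g' := by
    have h : autHom M (g * g') = autHom M g' ≫ autHom M g := rfl
    rw [h, F.obj.map_comp]
    exact Finsupp.lmapDomain_comp K K (F.obj.map (autHom M g')) (F.obj.map (autHom M g))

variable {K} {M : AddSpan Ms} {V : Type x} [AddCommGroup V] [Module K V]

/-- `V` is an irreducible representation with `Hom(KF(M), V) ≠ 0` and `Hom(KG(M), V) = 0` for
all `G ≺ F`. -/
def IsTypical (F : LinFun A Ms) (ρ : Representation K (AutGroup M) V) : Prop :=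
  ρ.IsIrreducible ∧
  (∃ f : (permRep K F M).IntertwiningMap ρ, f ≠ 0) ∧
  ∀ G : LinFun A Ms, IsProperSubquotient G F →
    ∀ f : (permRep K G M).IntertwiningMap ρ, f = 0

/-- `V` is isomorphic to a subrepresentation of `KF(M)`. -/
def Embeds (ρ : Representation K (AutGroup M) V) (F : LinFun A Ms) : Prop :=
  ∃ f : ρ.IntertwiningMap (permRep K F M), Function.Injective f

open scoped Classical in
/-- The representation `V` is the direct sum of the subrepresentations `U i`. -/
def IsDirectSumOf {ι : Type y} (ρ : Representation K (AutGroup M) V)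
    (U : ι → Subrepresentation ρ) : Prop :=
  DirectSum.IsInternal fun i => (U i).toSubmodule

/-- `V` belongs to the stratum `Rep(Aut_R(M))_F`: it is the direct sum of finitely many
`F`-typical irreducible representations. -/
def InStratum (F : LinFun A Ms) (ρ : Representation K (AutGroup M) V) : Prop :=
  ∃ (n : ℕ) (U : Fin n → Subrepresentation ρ),
    (∀ i, IsTypical F (U i).toRepresentation) ∧ IsDirectSumOf ρ U

/-- Membership in the stratum attached to an isomorphism class of functors. -/
def InStratumClass (c : IsoClass A Ms) (ρ : Representation K (AutGroup M) V) : Prop :=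
  ∃ F : LinFun A Ms, (⟦F⟧ : IsoClass A Ms) = c ∧ InStratum F ρ

end Representations

end FunctorMorphing

end

/-!
Fix an irreducible representation `V` of `Aut_R(M)`. It occurs in `K Hom(M, M)`, because `Aut_R(M)`
acts freely on itself. So among the quotients `F` of `Hom(M, -)` for which `V` occurs in `KF(M)`
there is one that is minimal, first at `M` and then at the other objects, and this `F` is typical.

For uniqueness, suppose that `V` occurs in both `KF(M)` and `KG(M)`. By semisimplicity there is an
intertwiner `KF(M) → KG(M)` through `V`, that is, an `Aut_R(M)`-invariant function on
`F(M) × G(M)`. Units of quotients of the finite ring `End_R(M)` lift to units, so generators of the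
same cyclic `End_R(M)`-submodule are conjugate under `Aut_R(M)`, and invariant functions are linear
combinations of indicators of cyclic submodules `End_R(M) (f, g)`. One of these indicators is
non-zero on `V`, and it factors through the largest common quotient of the subfunctors of `F` and
`G` generated by `f` and `g`. Hence `V` already occurs in a common subquotient of `F` and `G`, which
is isomorphic to both when `F` and `G` are typical for `V`.
-/

noncomputable section

namespace FunctorMorphing

section CyclicIndicators

open Submodule

variable (K S N : Type*) [Ring K] [Ring S] [AddCommGroup N] [Module S N]

/-- The span of the indicator functions of the cyclic `S`-submodules of `N`, inside the `K`-valued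
functions on `N`. -/
def cyclicIndicatorSpan : Submodule K (N → K) :=
  span K (Set.range fun z : N => (span S {z} : Set N).indicator 1)

variable {S N}

/-- The set of generators of a submodule `T`; it is empty unless `T` is cyclic. -/
def generators (T : Submodule S N) : Set N := {z | span S {z} = T}

theorem indicator_span_singleton_mem (z : N) :
    (span S {z} : Set N).indicator 1 ∈ cyclicIndicatorSpan K S N :=
  subset_span ⟨z, rfl⟩

theorem sum_smul_indicator_generators_apply [Fintype (Submodule S N)] (c : Submodule S N → K)
    (z : N) : (∑ T, c T • (generators T).indicator (1 : N → K)) z = c (span S {z}) := by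
  classical
  simp [Finset.sum_apply, Set.indicator_apply, generators]

variable [Finite N]

theorem indicator_generators_mem (T : Submodule S N) :
    (generators T).indicator 1 ∈ cyclicIndicatorSpan K S N := by
  classical
  have := Fintype.ofFinite (Submodule S N)
  induction T using WellFoundedLT.induction with
  | ind T ih =>
    rcases (generators T).eq_empty_or_nonempty with hT | ⟨z, rfl⟩
    · rw [hT, Set.indicator_empty]
      exact zero_mem _
    set T := span S {z}
    have hsum : (T : Set N).indicator (1 : N → K) = (generators T).indicator 1 +
        ∑ T', (if T' < T then 1 else 0 : K) • (generators T').indicator 1 := by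
      funext y
      rw [Pi.add_apply, sum_smul_indicator_generators_apply]
      have hy : y ∈ T ↔ span S {y} = T ∨ span S {y} < T := by
        rw [← le_iff_eq_or_lt, span_singleton_le_iff_mem]
      by_cases heq : span S {y} = T <;> simp [Set.indicator_apply, generators, hy, heq]
    rw [← add_sub_cancel_right ((generators T).indicator 1), ← hsum]
    refine sub_mem (indicator_span_singleton_mem K z) (sum_mem fun T' _ => ?_)
    split_ifs with hlt
    · exact smul_mem _ _ (ih T' hlt)
    · rw [zero_smul]
      exact zero_mem _

variable {K}

theorem mem_cyclicIndicatorSpan_of_factorsThrough {h : N → K}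
    (hh : h.FactorsThrough fun z => span S {z}) : h ∈ cyclicIndicatorSpan K S N := by
  have := Fintype.ofFinite (Submodule S N)
  obtain ⟨c, hc⟩ := (Function.factorsThrough_iff h).1 hh
  have hsum : ∑ T, c T • (generators T).indicator 1 = h := by
    funext z
    rw [sum_smul_indicator_generators_apply, hc, Function.comp_apply]
  exact hsum ▸ sum_mem fun T _ => smul_mem _ _ (indicator_generators_mem K T)

end CyclicIndicators

section Lifting

open Submodule

open scoped Classical in
/-- The sum of an integer-valued function over the fibre of `π` at `y`. -/
def fiberSum {P N : Type*} [Fintype P] (π : P → N) (y : N) : (P → ℤ) →ₗ[ℤ] ℤ :=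
  ∑ x with π x = y, LinearMap.proj x

theorem fiberSum_apply {P N : Type*} [Fintype P] [DecidableEq N] (π : P → N) (y : N) (h : P → ℤ) :
    fiberSum π y h = ∑ x with π x = y, h x := by
  simp only [fiberSum, LinearMap.sum_apply, LinearMap.proj_apply]
  congr!

variable {S P N : Type*} [Ring S] [AddCommGroup P] [Module S P] [AddCommGroup N] [Module S N]

theorem fiberSum_indicator_eq [Fintype P] (π : P →ₗ[S] N) {y y' : N}
    (h : span S {y} = span S {y'}) (T : Submodule S P) :
    fiberSum π y ((T : Set P).indicator 1) = fiberSum π y' ((T : Set P).indicator 1) := by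
  classical
  obtain ⟨a, rfl⟩ := mem_span_singleton.1 (h ▸ mem_span_singleton_self y')
  obtain ⟨b, hb⟩ := mem_span_singleton.1 (h ▸ mem_span_singleton_self y)
  simp only [fiberSum_apply]
  by_cases hT : ∃ x ∈ T, π x = y
  · obtain ⟨x₀, hx₀, rfl⟩ := hT
    have hd : a • x₀ - x₀ ∈ T := T.sub_mem (T.smul_mem a hx₀) hx₀
    refine Finset.sum_equiv (Equiv.addRight (a • x₀ - x₀)) (fun x => ?_) fun x _ => ?_
    · simp [add_sub, sub_eq_iff_eq_add, add_comm (a • π x₀)]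
    · simp [Set.indicator_apply, T.add_mem_iff_left hd]
  · push Not at hT
    have hT' (x) (hx : x ∈ T) : π x ≠ a • y := fun hxy =>
      hT (b • x) (T.smul_mem b hx) (by rw [map_smul, hxy, hb])
    rw [Finset.sum_eq_zero, Finset.sum_eq_zero]
    all_goals
      intro x hx
      simp only [Finset.mem_filter_univ] at hx
      refine Set.indicator_of_notMem (fun hxT => ?_) _
    · exact hT' x hxT hx
    · exact hT x hxT hx

/-- Gaschütz's lemma for cyclic modules: the number of generators of a submodule of `P` lying over
`y` is an integral combination of the numbers of elements over `y` of the cyclic submodules of `P`,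
each of which only depends on the submodule generated by `y`. -/
theorem exists_span_eq_map_eq [Finite P] (π : P →ₗ[S] N) (x : P) {y : N}
    (h : span S {π x} = span S {y}) : ∃ x', span S {x'} = span S {x} ∧ π x' = y := by
  classical
  have := Fintype.ofFinite P
  have hle : cyclicIndicatorSpan ℤ S P ≤ LinearMap.eqLocus (fiberSum π (π x)) (fiberSum π y) :=
    span_le.2 <| Set.range_subset_iff.2 fun z => fiberSum_indicator_eq π h (span S {z})
  have hsum := hle (indicator_generators_mem ℤ (span S {x}))
  simp only [LinearMap.mem_eqLocus, fiberSum_apply] at hsum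
  have hpos : 0 < ∑ x' with π x' = π x, (generators (span S {x})).indicator (1 : P → ℤ) x' :=
    Finset.sum_pos' (fun x' _ => Set.indicator_nonneg (fun _ _ => zero_le_one) x')
      ⟨x, by simp [generators]⟩
  obtain ⟨x', hx', hne⟩ := Finset.exists_ne_zero_of_sum_ne_zero (hsum ▸ hpos.ne')
  exact ⟨x', Set.mem_of_indicator_ne_zero (s := generators _) hne,
    (Finset.mem_filter_univ x').1 hx'⟩

theorem exists_units_smul_eq [Finite S] {y y' : N} (h : span S {y} = span S {y'}) :
    ∃ u : Sˣ, u • y = y' := by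
  rw [← one_smul S y] at h
  obtain ⟨s, hs, rfl⟩ := exists_span_eq_map_eq (LinearMap.toSpanSingleton S N y) 1 h
  obtain ⟨t, ht⟩ := mem_span_singleton.1 (hs ▸ mem_span_singleton_self (1 : S))
  obtain ⟨u, rfl⟩ : IsUnit s := IsUnit.of_mul_eq_one_right t ht
  exact ⟨u, rfl⟩

theorem mem_cyclicIndicatorSpan_of_units_smul_eq [Finite S] [Finite N] {K : Type*} [Ring K]
    {h : N → K} (hh : ∀ (u : Sˣ) z, h (u • z) = h z) : h ∈ cyclicIndicatorSpan K S N :=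
  mem_cyclicIndicatorSpan_of_factorsThrough fun _ _ hyz => by
    obtain ⟨u, rfl⟩ := exists_units_smul_eq hyz
    exact (hh u _).symm

end Lifting

section HomSubfunctors

variable {A : Type*} [CommRing A] {C : Type*} [Category.{v} C] [Preadditive C] [Linear A C]

/-- An `A`-linear subfunctor of the functor `Hom(M, -)`. -/
@[ext]
structure HomSubfunctor (A : Type*) [CommRing A] {C : Type*} [Category.{v} C] [Preadditive C]
    [Linear A C] (M : C) where
  /-- The values of the subfunctor. -/
  carrier (X : C) : Submodule A (M ⟶ X)
  comp_mem {X Y : C} {a : M ⟶ X} (b : X ⟶ Y) : a ∈ carrier X → a ≫ b ∈ carrier Y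

namespace HomSubfunctor

variable {M : C}

instance : SemilatticeSup (HomSubfunctor A M) where
  __ := PartialOrder.lift carrier fun _ _ => HomSubfunctor.ext
  sup J J' :=
    { carrier X := J.carrier X ⊔ J'.carrier X
      comp_mem b h := by
        obtain ⟨c, hc, d, hd, rfl⟩ := Submodule.mem_sup.1 h
        rw [Preadditive.add_comp]
        exact Submodule.add_mem_sup (J.comp_mem b hc) (J'.comp_mem b hd) }
  le_sup_left _ _ _ := le_sup_left
  le_sup_right _ _ _ := le_sup_right
  sup_le _ _ _ h h' X := sup_le (h X) (h' X)

instance : OrderBot (HomSubfunctor A M) where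
  bot :=
    { carrier _ := ⊥
      comp_mem b h := by
        rw [(Submodule.mem_bot A).1 h, Limits.zero_comp]
        exact zero_mem _ }
  bot_le _ _ := bot_le

/-- The quotient of `Hom(M, -)` by a subfunctor. -/
def quotient (J : HomSubfunctor A M) : C ⥤ ModuleCat.{v} A where
  obj X := ModuleCat.of A ((M ⟶ X) ⧸ J.carrier X)
  map {X Y} b := ModuleCat.ofHom ((J.carrier X).mapQ (J.carrier Y) (Linear.rightComp A M b)
    fun _ => J.comp_mem b)
  map_id X := by
    ext a
    exact congrArg (J.carrier X).mkQ (Category.comp_id a)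
  map_comp {X Y Z} b c := by
    ext a
    exact congrArg (J.carrier Z).mkQ (Category.assoc a b c).symm

/-- The class of a morphism in the quotient of `Hom(M, -)` by `J`. -/
def cls (J : HomSubfunctor A M) {X : C} (a : M ⟶ X) : J.quotient.obj X :=
  (J.carrier X).mkQ a

variable {J : HomSubfunctor A M} {X Y : C}

theorem cls_surjective : Function.Surjective (J.cls : (M ⟶ X) → J.quotient.obj X) :=
  (J.carrier X).mkQ_surjective

instance : J.quotient.Additive where
  map_add {_ Y b c} := by
    ext z
    obtain ⟨a, rfl⟩ := cls_surjective z
    exact congrArg (J.cls (X := Y)) (Preadditive.comp_add _ _ _ a b c)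

instance : J.quotient.Linear A where
  map_smul {_ Y} b r := by
    ext z
    obtain ⟨a, rfl⟩ := cls_surjective z
    exact congrArg (J.cls (X := Y)) (Linear.comp_smul _ _ _ a r b)

theorem quotient_map_cls (b : X ⟶ Y) (a : M ⟶ X) : J.quotient.map b (J.cls a) = J.cls (a ≫ b) :=
  rfl

theorem quotient_map_cls_id (a : M ⟶ X) : J.quotient.map a (J.cls (𝟙 M)) = J.cls a := by
  rw [quotient_map_cls, Category.id_comp]

theorem cls_eq_zero {a : M ⟶ X} : J.cls a = 0 ↔ a ∈ J.carrier X :=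
  Submodule.Quotient.mk_eq_zero _

theorem cls_eq_cls {a b : M ⟶ X} : J.cls a = J.cls b ↔ a - b ∈ J.carrier X :=
  Submodule.Quotient.eq _

instance [Finite (M ⟶ X)] : Finite (J.quotient.obj X) :=
  Finite.of_surjective J.cls cls_surjective

variable (F : C ⥤ ModuleCat.{v} A) [F.Additive] [F.Linear A]

/-- The natural transformation `Hom(M, -) ⟶ F` attached to an element of `F(M)` by the Yoneda lemma,
evaluated at `X`. -/
def evalAt (f : F.obj M) (X : C) : (M ⟶ X) →ₗ[A] F.obj X where
  toFun a := F.map a f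
  map_add' a b := by rw [F.map_add]; rfl
  map_smul' r a := by rw [F.map_smul]; rfl

/-- The kernel of the natural transformation `Hom(M, -) ⟶ F` attached to an element of `F(M)`. -/
def ker (f : F.obj M) : HomSubfunctor A M where
  carrier X := LinearMap.ker (evalAt F f X)
  comp_mem {X Y a} b (ha : F.map a f = 0) := show F.map (a ≫ b) f = 0 by
    rw [F.map_comp_apply, ha, map_zero]

variable {F} {f : F.obj M}

theorem mem_ker {a : M ⟶ X} : a ∈ (ker F f).carrier X ↔ F.map a f = 0 := Iff.rfl

theorem ker_cls_id (J : HomSubfunctor A M) : ker J.quotient (J.cls (𝟙 M)) = J := by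
  ext X a
  rw [mem_ker, quotient_map_cls_id, cls_eq_zero]

/-- The natural transformation `Hom(M, -)/J ⟶ F` attached to an element of `F(M)` that is
annihilated by `J`. -/
def desc (h : J ≤ ker F f) : J.quotient ⟶ F where
  app X := ModuleCat.ofHom ((J.carrier X).liftQ (evalAt F f X) (h X))
  naturality X Y b := by
    ext z
    obtain ⟨a, rfl⟩ := cls_surjective z
    exact F.map_comp_apply a b f

theorem desc_app_cls (h : J ≤ ker F f) (a : M ⟶ X) : (desc h).app X (J.cls a) = F.map a f := rfl

theorem desc_app_injective (X : C) : Function.Injective ((desc (le_refl (ker F f))).app X) := by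
  refine (injective_iff_map_eq_zero _).2 fun z hz => ?_
  obtain ⟨a, rfl⟩ := cls_surjective z
  exact cls_eq_zero.2 hz

theorem desc_app_surjective {J' : HomSubfunctor A M} (h : J' ≤ ker J.quotient (J.cls (𝟙 M)))
    (X : C) : Function.Surjective ((desc h).app X) := fun z => by
  obtain ⟨a, rfl⟩ := cls_surjective z
  exact ⟨J'.cls a, by rw [desc_app_cls, quotient_map_cls_id]⟩

/-- The largest subfunctor of `Hom(M, -)` whose value at `M` is that of `J`. -/
def saturate (J : HomSubfunctor A M) : HomSubfunctor A M where
  carrier X := ⨅ b : X ⟶ M, (J.carrier M).comap (Linear.rightComp A M b)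
  comp_mem b h := by
    simp only [Submodule.mem_iInf, Submodule.mem_comap, Linear.rightComp_apply,
      Category.assoc] at h ⊢
    exact fun c => h (b ≫ c)

theorem mem_saturate {a : M ⟶ X} :
    a ∈ J.saturate.carrier X ↔ ∀ b : X ⟶ M, a ≫ b ∈ J.carrier M := by
  simp only [saturate, Submodule.mem_iInf, Submodule.mem_comap, Linear.rightComp_apply]

theorem le_saturate : J ≤ J.saturate := fun _ _ h => mem_saturate.2 fun b => J.comp_mem b h

theorem saturate_carrier_self : J.saturate.carrier M = J.carrier M :=
  le_antisymm (fun a h => by simpa only [Category.comp_id] using mem_saturate.1 h (𝟙 M))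
    (le_saturate M)

variable {H G : C ⥤ ModuleCat.{v} A}

theorem app_surjective_of_app_self_surjective (i : H ⟶ J.quotient)
    (hM : Function.Surjective (i.app M)) (X : C) : Function.Surjective (i.app X) := fun z => by
  obtain ⟨a, rfl⟩ := cls_surjective z
  obtain ⟨y, hy⟩ := hM (J.cls (𝟙 M))
  exact ⟨H.map a y, by rw [NatTrans.naturality_apply, hy, quotient_map_cls_id]⟩

theorem eq_zero_of_forall_map_eq_zero {z : J.saturate.quotient.obj X}
    (hz : ∀ b : X ⟶ M, J.saturate.quotient.map b z = 0) : z = 0 := by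
  obtain ⟨a, rfl⟩ := cls_surjective z
  refine cls_eq_zero.2 (mem_saturate.2 fun b => ?_)
  rw [← saturate_carrier_self, ← cls_eq_zero, ← quotient_map_cls, hz b]

theorem app_injective_of_app_self_injective (i : H ⟶ J.saturate.quotient)
    (hi : ∀ X, Function.Injective (i.app X)) (p : H ⟶ G) (hM : Function.Injective (p.app M))
    (X : C) : Function.Injective (p.app X) := by
  refine (injective_iff_map_eq_zero _).2 fun z hz => hi X ?_
  rw [map_zero]
  refine eq_zero_of_forall_map_eq_zero fun b => ?_
  have hbz : H.map b z = 0 := hM <| by rw [NatTrans.naturality_apply, hz, map_zero, map_zero]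
  rw [← NatTrans.naturality_apply, hbz, map_zero]

end HomSubfunctor

end HomSubfunctors

section LinearFunctors

open HomSubfunctor
open scoped ModuleCat.Algebra

variable {A : Type u₁} [CommRing A] {R : Type u₂} [Ring R] [Algebra A R]
  {k : ℕ} {Ms : Fin k → ModuleCat.{v} R}

theorem finite_of_addSpan (hfin : ∀ i, Finite (Ms i)) (X : AddSpan Ms) : Finite X.obj := by
  obtain ⟨a, ⟨e⟩⟩ := X.property
  exact Finite.of_equiv _ e.symm.toEquiv

theorem finite_hom (hfin : ∀ i, Finite (Ms i)) (X Y : AddSpan Ms) : Finite (X ⟶ Y) := by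
  have := finite_of_addSpan hfin X
  have := finite_of_addSpan hfin Y
  refine Finite.of_injective (fun f : X ⟶ Y => (f.hom : X.obj → Y.obj)) fun f g h => ?_
  ext x
  exact congrFun h x

instance (F : LinFun A Ms) : F.obj.Additive := F.property.1

instance (F : LinFun A Ms) : F.obj.Linear A := F.property.2

variable {F G : LinFun A Ms} {M : AddSpan Ms}

theorem app_bijective (e : F ≅ G) (X : AddSpan Ms) : Function.Bijective (e.hom.hom.app X) :=
  (ConcreteCategory.isIso_iff_bijective _).1 (((ObjectProperty.ι _).mapIso e).app X).isIso_hom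

theorem nonempty_iso_of_bijective (i : F ⟶ G) (h : ∀ X, Function.Bijective (i.hom.app X)) :
    Nonempty (F ≅ G) := by
  have (X : AddSpan Ms) : IsIso (i.hom.app X) := (ConcreteCategory.isIso_iff_bijective _).2 (h X)
  have : IsIso i.hom := NatIso.isIso_of_isIso_app _
  exact ⟨ObjectProperty.isoMk _ (asIso i.hom)⟩

theorem IsSubquotient.trans_iso {F' : LinFun A Ms} (h : IsSubquotient G F) (e : F ≅ F') :
    IsSubquotient G F' := by
  obtain ⟨H, i, p, hi, hp⟩ := h
  exact ⟨H, i ≫ e.hom, p, fun X => by simpa using (app_bijective e X).1.comp (hi X), hp⟩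

theorem IsSubquotient.finite (h : IsSubquotient G F) (X : AddSpan Ms) [Finite (F.obj.obj X)] :
    Finite (G.obj.obj X) := by
  obtain ⟨H, i, p, hi, hp⟩ := h
  have := Finite.of_injective _ (hi X)
  exact Finite.of_surjective _ (hp X)

theorem IsSubquotient.card_le (h : IsSubquotient G F) (X : AddSpan Ms) [Finite (F.obj.obj X)] :
    Nat.card (G.obj.obj X) ≤ Nat.card (F.obj.obj X) := by
  obtain ⟨H, i, p, hi, hp⟩ := h
  have := Finite.of_injective _ (hi X)
  exact (Nat.card_le_card_of_surjective _ (hp X)).trans (Nat.card_le_card_of_injective _ (hi X))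

/-- The quotient of `Hom(M, -)` by a subfunctor, as an object of `𝒞₊₁`. -/
def HomSubfunctor.linFun (J : HomSubfunctor A M) : LinFun A Ms :=
  ⟨J.quotient, inferInstance, inferInstance⟩

instance (J : HomSubfunctor A M) (X : AddSpan Ms) [Finite (M ⟶ X)] :
    Finite (J.linFun.obj.obj X) :=
  inferInstanceAs (Finite (J.quotient.obj X))

theorem isSubquotient_linFun {J : HomSubfunctor A M} {f : F.obj.obj M} (h : ker F.obj f ≤ J) :
    IsSubquotient J.linFun F :=
  have h' : ker F.obj f ≤ ker J.quotient (J.cls (𝟙 M)) := by rwa [ker_cls_id]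
  ⟨(ker F.obj f).linFun, ObjectProperty.homMk (desc le_rfl), ObjectProperty.homMk (desc h'),
    desc_app_injective, desc_app_surjective h'⟩

theorem nonempty_iso_of_isSubquotient {J : HomSubfunctor A M} [Finite (M ⟶ M)]
    (h : IsSubquotient G J.saturate.linFun)
    (hcard : Nat.card (J.saturate.linFun.obj.obj M) ≤ Nat.card (G.obj.obj M)) :
    Nonempty (G ≅ J.saturate.linFun) := by
  obtain ⟨H, i, p, hi, hp⟩ := h
  have hfin : Finite (H.obj.obj M) := Finite.of_injective _ (hi M)
  have hiM : Nat.card (H.obj.obj M) ≤ Nat.card (J.saturate.linFun.obj.obj M) :=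
    Nat.card_le_card_of_injective _ (hi M)
  have hpM : Nat.card (G.obj.obj M) ≤ Nat.card (H.obj.obj M) :=
    Nat.card_le_card_of_surjective _ (hp M)
  have hi_surj := app_surjective_of_app_self_surjective (J := J.saturate) i.hom
    ((Nat.bijective_iff_injective_and_card _).2 ⟨hi M, by omega⟩).2
  have hp_inj := app_injective_of_app_self_injective i.hom hi p.hom
    ((Nat.bijective_iff_surjective_and_card _).2 ⟨hp M, by omega⟩).1
  obtain ⟨e⟩ := nonempty_iso_of_bijective i fun X => ⟨hi X, hi_surj X⟩
  obtain ⟨e'⟩ := nonempty_iso_of_bijective p fun X => ⟨hp_inj X, hp X⟩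
  exact ⟨e'.symm.trans e⟩

end LinearFunctors

section KernelSums

open Submodule

variable {K N₁ N₂ V : Type*} [CommRing K] [Fintype N₂] [AddCommGroup V] [Module K V]

/-- The operator `h ↦ ∑ y, h(x, y) p(y)` on kernels `h : N₁ × N₂ → K`. -/
def kernelSum (p : N₂ → V) (x : N₁) : (N₁ × N₂ → K) →ₗ[K] V :=
  Fintype.linearCombination K p ∘ₗ LinearMap.funLeft K K (Prod.mk x)

variable {p : N₂ → V} {x : N₁}

theorem kernelSum_apply (h : N₁ × N₂ → K) : kernelSum p x h = ∑ y, h (x, y) • p y :=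
  Fintype.linearCombination_apply K p _

theorem exists_mem_of_kernelSum_indicator_ne_zero {T : Set (N₁ × N₂)}
    (h : kernelSum p x (T.indicator (1 : N₁ × N₂ → K)) ≠ 0) : ∃ y, (x, y) ∈ T := by
  rw [kernelSum_apply] at h
  obtain ⟨y, -, hy⟩ := Finset.exists_ne_zero_of_sum_ne_zero h
  exact ⟨y, Set.mem_of_indicator_ne_zero (left_ne_zero_of_smul hy)⟩

theorem kernelSum_smul {G : Type*} [Group G] [MulAction G N₁] [MulAction G N₂]
    {ρ : Representation K G V} (hp : ∀ (g : G) y, p (g • y) = ρ g (p y)) {h : N₁ × N₂ → K}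
    (hh : ∀ (g : G) z, h (g • z) = h z) (g : G) :
    kernelSum p (g • x) h = ρ g (kernelSum p x h) := by
  simp only [kernelSum_apply, map_sum, map_smul, ← hp]
  rw [← Equiv.sum_comp (MulAction.toPerm g)]
  exact Finset.sum_congr rfl fun y _ => congrArg (· • p (g • y)) (hh g (x, y))

variable {S : Type*} [Ring S] [AddCommGroup N₁] [AddCommGroup N₂] [Module S N₁] [Module S N₂]

theorem kernelSum_add_indicator {T : Submodule S (N₁ × N₂)} {d : N₁} (hd : (d, 0) ∈ T) :
    kernelSum p (d + x) ((T : Set (N₁ × N₂)).indicator (1 : N₁ × N₂ → K)) =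
      kernelSum p x ((T : Set (N₁ × N₂)).indicator (1 : N₁ × N₂ → K)) := by
  classical
  simp only [kernelSum_apply]
  refine Finset.sum_congr rfl fun y _ => ?_
  have hmem : (d + x, y) ∈ T ↔ (x, y) ∈ T := by
    simpa only [Prod.mk_add_mk, zero_add] using T.add_mem_iff_right (y := (x, y)) hd
  simp only [Set.indicator_apply, SetLike.mem_coe, hmem, Pi.one_apply]

theorem exists_kernelSum_indicator_ne_zero {h : N₁ × N₂ → K}
    (hh : h ∈ cyclicIndicatorSpan K S (N₁ × N₂)) (hne : kernelSum p x h ≠ 0) :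
    ∃ z : N₁ × N₂,
      kernelSum p x ((span S {z} : Set (N₁ × N₂)).indicator (1 : N₁ × N₂ → K)) ≠ 0 := by
  by_contra! hzero
  have hle : cyclicIndicatorSpan K S (N₁ × N₂) ≤ LinearMap.ker (kernelSum p x) :=
    span_le.2 (Set.range_subset_iff.2 hzero)
  exact hne (hle hh)

end KernelSums

section Semisimplicity

variable {K G V W : Type*} [Field K] [Group G] [Finite G] [NeZero (Nat.card G : K)]
  [AddCommGroup V] [Module K V] [AddCommGroup W] [Module K W]
  {ρ : Representation K G V} {σ : Representation K G W}

open Representation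

theorem exists_section (p : IntertwiningMap ρ σ) (hp : Function.Surjective p) :
    ∃ i : IntertwiningMap σ ρ, ∀ w, p (i w) = w := by
  obtain ⟨i, hi⟩ := IsSemisimpleModule.lifting_property
    (IntertwiningMap.equivLinearMapAsModule ρ σ p) hp LinearMap.id
  exact ⟨(IntertwiningMap.equivLinearMapAsModule σ ρ).symm i, fun w => LinearMap.congr_fun hi w⟩

theorem exists_retraction (i : IntertwiningMap ρ σ) (hi : Function.Injective i) :
    ∃ p : IntertwiningMap σ ρ, ∀ w, p (i w) = w := by
  obtain ⟨p, hp⟩ := IsSemisimpleModule.extension_property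
    (IntertwiningMap.equivLinearMapAsModule ρ σ i) hi LinearMap.id
  exact ⟨(IntertwiningMap.equivLinearMapAsModule σ ρ).symm p, fun w => LinearMap.congr_fun hp w⟩

end Semisimplicity

section Typical

open HomSubfunctor
open scoped ModuleCat.Algebra

variable {A : Type u₁} [CommRing A] {R : Type u₂} [Ring R] [Algebra A R]
  {k : ℕ} {Ms : Fin k → ModuleCat.{v} R} {M : AddSpan Ms} {F G : LinFun A Ms}

theorem autHom_injective : Function.Injective (autHom M) := fun g g' h => by
  ext z
  exact congrArg (fun a : M ⟶ M => a.hom z) h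

theorem autHom_one : autHom M 1 = 𝟙 M := rfl

theorem autHom_mul (g g' : AutGroup M) : autHom M (g * g') = autHom M g' ≫ autHom M g := rfl

theorem exists_autHom_eq (u : (End M)ˣ) : ∃ g : AutGroup M, autHom M g = (u : End M) := by
  refine ⟨LinearEquiv.ofLinearMap (u : End M).hom.hom (u⁻¹ : (End M)ˣ).1.hom.hom ?_ ?_, rfl⟩
  · ext z
    exact congrArg (fun a : End M => a.hom z) u.mul_inv
  · ext z
    exact congrArg (fun a : End M => a.hom z) u.inv_mul

instance [Finite (M ⟶ M)] : Finite (AutGroup M) := Finite.of_injective _ autHom_injective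

/-- The action of `Aut_R(M)` on the set `F(M)`. -/
instance (F : LinFun A Ms) : MulAction (AutGroup M) (F.obj.obj M) where
  smul g z := F.obj.map (autHom M g) z
  one_smul z := F.obj.map_id_apply M z
  mul_smul g g' z := F.obj.map_comp_apply (autHom M g') (autHom M g) z

theorem autGroup_smul_def (g : AutGroup M) (z : F.obj.obj M) : g • z = F.obj.map (autHom M g) z :=
  rfl

theorem app_smul (e : F ⟶ G) (g : AutGroup M) (z : F.obj.obj M) :
    e.hom.app M (g • z) = g • e.hom.app M z :=
  NatTrans.naturality_apply e.hom (autHom M g) z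

/-- The structure of a module over the endomorphism ring of `M` on the value at `M` of an additive
functor. -/
@[reducible]
def endModule {C : Type*} [Category C] [Preadditive C] {B : Type*} [Ring B] (F : C ⥤ ModuleCat B)
    [F.Additive] (M : C) : Module (End M) (F.obj M) where
  smul a z := F.map a z
  one_smul z := F.map_id_apply M z
  mul_smul a b z := F.map_comp_apply b a z
  smul_zero a := map_zero (F.map a).hom
  smul_add a := map_add (F.map a).hom
  add_smul _ _ z := ConcreteCategory.congr_hom F.map_add z
  zero_smul z := ConcreteCategory.congr_hom (F.map_zero M M) z

variable {K : Type w} [Field K] {V : Type x} [AddCommGroup V] [Module K V]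
  {ρ : Representation K (AutGroup M) V}

theorem permRep_single (g : AutGroup M) (z : F.obj.obj M) (c : K) :
    permRep K F M g (Finsupp.single z c) = Finsupp.single (g • z) c :=
  Finsupp.mapDomain_single

theorem permRep_smul_apply (g : AutGroup M) (z : F.obj.obj M) (m : F.obj.obj M →₀ K) :
    permRep K F M g m (g • z) = m z :=
  Finsupp.mapDomain_apply (MulAction.injective g) m z

/-- `Hom(KF(M), V) ≠ 0`. -/
def HasNonzeroHom (F : LinFun A Ms) (ρ : Representation K (AutGroup M) V) : Prop :=
  ∃ f : (permRep K F M).IntertwiningMap ρ, f ≠ 0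

theorem isTypical_iff : IsTypical F ρ ↔ ρ.IsIrreducible ∧ HasNonzeroHom F ρ ∧
    ∀ G : LinFun A Ms, IsProperSubquotient G F → ¬ HasNonzeroHom G ρ := by
  simp only [IsTypical, HasNonzeroHom, not_exists, not_not]

theorem hasNonzeroHom_iff : HasNonzeroHom F ρ ↔ ∃ ψ : F.obj.obj M → V,
    (∀ (g : AutGroup M) z, ψ (g • z) = ρ g (ψ z)) ∧ ∃ z, ψ z ≠ 0 := by
  constructor
  · rintro ⟨f, hf⟩
    refine ⟨fun z => f (Finsupp.single z 1), fun g z => ?_, ?_⟩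
    · rw [← f.isIntertwining, permRep_single]
    · by_contra! h
      refine hf ?_
      ext z
      simpa using h z
  · rintro ⟨ψ, hψ, z, hz⟩
    refine ⟨⟨Finsupp.linearCombination K ψ, fun g => ?_⟩, fun h => hz ?_⟩
    · ext z
      simp [permRep_single, hψ]
    · simpa using DFunLike.congr_fun h (Finsupp.single z 1)

theorem hasNonzeroHom_of_hom (e : F ⟶ G) {ψ : G.obj.obj M → V}
    (hψ : ∀ (g : AutGroup M) z, ψ (g • z) = ρ g (ψ z)) {y : F.obj.obj M}
    (hy : ψ (e.hom.app M y) ≠ 0) : HasNonzeroHom F ρ :=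
  hasNonzeroHom_iff.2 ⟨fun y => ψ (e.hom.app M y), fun g y =>
    (congrArg ψ (app_smul e g y)).trans (hψ g _), y, hy⟩

theorem HasNonzeroHom.of_iso (h : HasNonzeroHom F ρ) (e : F ≅ G) : HasNonzeroHom G ρ := by
  obtain ⟨ψ, hψ, z, hz⟩ := hasNonzeroHom_iff.1 h
  obtain ⟨y, rfl⟩ := (app_bijective e.symm M).2 z
  exact hasNonzeroHom_of_hom e.inv hψ hz

theorem HasNonzeroHom.exists_ker (h : HasNonzeroHom F ρ) :
    ∃ f : F.obj.obj M, HasNonzeroHom (ker F.obj f).linFun ρ := by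
  obtain ⟨ψ, hψ, f, hf⟩ := hasNonzeroHom_iff.1 h
  let i : (ker F.obj f).linFun ⟶ F := ObjectProperty.homMk (desc le_rfl)
  have hi : i.hom.app M ((ker F.obj f).cls (𝟙 M)) = f := F.obj.map_id_apply M f
  exact ⟨f, hasNonzeroHom_of_hom i hψ (hi.symm ▸ hf)⟩

theorem hasNonzeroHom_linFun {J : HomSubfunctor A M} {φ : (M ⟶ M) → V}
    (hφ : ∀ g a, φ (a ≫ autHom M g) = ρ g (φ a)) (hJ : φ.FactorsThrough J.cls) {a : M ⟶ M}
    (ha : φ a ≠ 0) : HasNonzeroHom J.linFun ρ := by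
  obtain ⟨ψ, rfl⟩ := (Function.factorsThrough_iff φ).1 hJ
  refine hasNonzeroHom_iff.2 ⟨ψ, fun g z => ?_, J.cls a, ha⟩
  obtain ⟨b, rfl⟩ := cls_surjective z
  exact hφ g b

theorem HasNonzeroHom.saturate {J : HomSubfunctor A M} (h : HasNonzeroHom J.linFun ρ) :
    HasNonzeroHom J.saturate.linFun ρ := by
  obtain ⟨ψ, hψ, z, hz⟩ := hasNonzeroHom_iff.1 h
  obtain ⟨a, rfl⟩ := cls_surjective z
  refine hasNonzeroHom_linFun (φ := fun a => ψ (J.cls a)) (fun g a => hψ g (J.cls a))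
    (fun a b hab => congrArg ψ (cls_eq_cls.2 ?_)) hz
  rwa [cls_eq_cls, saturate_carrier_self] at hab

variable (A) in
theorem hasNonzeroHom_bot [Nontrivial V] (ρ : Representation K (AutGroup M) V) :
    HasNonzeroHom (⊥ : HomSubfunctor A M).linFun ρ := by
  obtain ⟨v, hv⟩ := exists_ne (0 : V)
  -- `Aut_R(M)` acts freely on itself and preserves its complement in `End_R(M)`.
  let φ : (M ⟶ M) → V := Function.extend (autHom M) (fun g => ρ g v) 0
  have hφ (g : AutGroup M) : φ (autHom M g) = ρ g v := autHom_injective.extend_apply _ _ g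
  refine hasNonzeroHom_linFun (φ := φ) (fun g a => ?_)
    (fun a b hab => congrArg φ (sub_eq_zero.1 (cls_eq_cls.1 hab))) (a := autHom M 1) ?_
  · by_cases ha : ∃ g', autHom M g' = a
    · obtain ⟨g', rfl⟩ := ha
      rw [← autHom_mul, hφ, hφ, map_mul, Module.End.mul_apply]
    · have ha' : ¬ ∃ g', autHom M g' = a ≫ autHom M g := by
        rintro ⟨g', hg'⟩
        refine ha ⟨g⁻¹ * g', ?_⟩
        rw [autHom_mul, hg', Category.assoc, ← autHom_mul, inv_mul_cancel, autHom_one,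
          Category.comp_id]
      simp only [φ, Function.extend_apply' _ _ _ ha, Function.extend_apply' _ _ _ ha',
        Pi.zero_apply, map_zero]
  · rwa [hφ, map_one, Module.End.one_apply]

theorem IsTypical.of_iso (h : IsTypical F ρ) (e : F ≅ G) : IsTypical G ρ := by
  rw [isTypical_iff] at h ⊢
  exact ⟨h.1, h.2.1.of_iso e, fun H hH => h.2.2 H
    ⟨hH.1.trans_iso e.symm, fun ⟨e'⟩ => hH.2 ⟨e'.trans e⟩⟩⟩

theorem IsTypical.nonempty_iso (h : IsTypical F ρ) (hG : IsSubquotient G F)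
    (hGρ : HasNonzeroHom G ρ) : Nonempty (G ≅ F) := by
  by_contra hne
  exact (isTypical_iff.1 h).2.2 G ⟨hG, hne⟩ hGρ

theorem IsTypical.exists_iso_linFun (h : IsTypical F ρ) :
    ∃ J : HomSubfunctor A M, Nonempty (J.linFun ≅ F) := by
  obtain ⟨f, hf⟩ := (isTypical_iff.1 h).2.1.exists_ker
  exact ⟨ker F.obj f, h.nonempty_iso (isSubquotient_linFun le_rfl) hf⟩

theorem IsTypical.finite (h : IsTypical F ρ) (X : AddSpan Ms) [Finite (M ⟶ X)] :
    Finite (F.obj.obj X) := by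
  obtain ⟨J, ⟨e⟩⟩ := h.exists_iso_linFun
  exact Finite.of_surjective _ (app_bijective e X).2

theorem nontrivial_of_isIrreducible (hρ : ρ.IsIrreducible) : Nontrivial V :=
  have := (Representation.irreducible_iff_isSimpleModule_asModule ρ).1 hρ
  IsSimpleModule.nontrivial (MonoidAlgebra K (AutGroup M)) ρ.asModule

variable (A) in
theorem exists_isTypical [Finite (M ⟶ M)] (hρ : ρ.IsIrreducible) :
    ∃ F : LinFun A Ms, IsTypical F ρ := by
  have := nontrivial_of_isIrreducible hρ
  obtain ⟨J, hJ, hmin⟩ := exists_minimalFor_of_wellFoundedLT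
    (fun J : HomSubfunctor A M => HasNonzeroHom J.linFun ρ)
    (fun J => Nat.card (J.linFun.obj.obj M)) ⟨⊥, hasNonzeroHom_bot A ρ⟩
  have hsat : IsSubquotient J.saturate.linFun J.linFun :=
    isSubquotient_linFun (f := J.cls (𝟙 M)) (le_of_eq_of_le (ker_cls_id J) le_saturate)
  refine ⟨J.saturate.linFun, isTypical_iff.2 ⟨hρ, hJ.saturate, fun G hG hGρ => hG.2 ?_⟩⟩
  refine nonempty_iso_of_isSubquotient hG.1 ((hsat.card_le M).trans ?_)
  obtain ⟨f, hf⟩ := hGρ.exists_ker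
  have := hG.1.finite M
  have hker : IsSubquotient (ker G.obj f).linFun G := isSubquotient_linFun le_rfl
  have hle := hker.card_le M
  exact (le_total _ _).elim (fun h => (hmin hf h).trans hle) fun h => h.trans hle

attribute [local instance] endModule

theorem autGroup_smul_mem_iff {N : Submodule (End M) (F.obj.obj M × G.obj.obj M)} (g : AutGroup M)
    {z : F.obj.obj M × G.obj.obj M} : g • z ∈ N ↔ z ∈ N := by
  have hsmul (g : AutGroup M) {z : F.obj.obj M × G.obj.obj M} (hz : z ∈ N) : g • z ∈ N :=
    N.smul_mem (autHom M g : End M) hz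
  exact ⟨fun h => by simpa only [inv_smul_smul] using hsmul g⁻¹ h, hsmul g⟩

theorem hasNonzeroHom_sup_ker [Fintype (G.obj.obj M)] {p : G.obj.obj M → V}
    (hp : ∀ (g : AutGroup M) y, p (g • y) = ρ g (p y)) {f f₀ : F.obj.obj M} {g₀ : G.obj.obj M}
    (hne : kernelSum p f ((Submodule.span (End M) {(f₀, g₀)} : Set _).indicator
      (1 : F.obj.obj M × G.obj.obj M → K)) ≠ 0) :
    HasNonzeroHom (ker F.obj f₀ ⊔ ker G.obj g₀).linFun ρ := by
  classical
  obtain ⟨y, hy⟩ := exists_mem_of_kernelSum_indicator_ne_zero hne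
  obtain ⟨a, ha⟩ := Submodule.mem_span_singleton.1 hy
  obtain rfl : F.obj.map a f₀ = f := congrArg Prod.fst ha
  set N := Submodule.span (End M) {(f₀, g₀)}
  refine hasNonzeroHom_linFun
    (φ := fun a => kernelSum p (F.obj.map a f₀) ((N : Set _).indicator (1 : _ × _ → K)))
    (fun g a => ?_) (fun a b hab => ?_) hne
  · beta_reduce
    rw [F.obj.map_comp_apply, ← autGroup_smul_def]
    exact kernelSum_smul hp (fun g z => by
      simp only [Set.indicator_apply, SetLike.mem_coe, autGroup_smul_mem_iff, Pi.one_apply]) g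
  · obtain ⟨c, hc, d, hd, hcd⟩ := Submodule.mem_sup.1 (cls_eq_cls.1 hab)
    have hmem : (F.obj.map d f₀, 0) ∈ N :=
      Submodule.mem_span_singleton.2 ⟨d, Prod.ext rfl hd⟩
    have hmap : evalAt F.obj f₀ M a = evalAt F.obj f₀ M d + evalAt F.obj f₀ M b := by
      rw [← sub_eq_iff_eq_add, ← map_sub, ← hcd, map_add, LinearMap.mem_ker.1 hc, zero_add]
    exact (congrArg (kernelSum p · _) hmap).trans (kernelSum_add_indicator hmem)

variable [Finite (M ⟶ M)] [NeZero (Nat.card (AutGroup M) : K)]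

theorem exists_kernelSum_ne_zero [Fintype (G.obj.obj M)] (hρ : ρ.IsIrreducible)
    (hF : HasNonzeroHom F ρ) (hG : HasNonzeroHom G ρ) :
    ∃ (p : G.obj.obj M → V) (h : F.obj.obj M × G.obj.obj M → K) (f : F.obj.obj M),
      (∀ (g : AutGroup M) y, p (g • y) = ρ g (p y)) ∧ (∀ (g : AutGroup M) z, h (g • z) = h z) ∧
        kernelSum p f h ≠ 0 := by
  obtain ⟨ψ, hψ, f, hf⟩ := hasNonzeroHom_iff.1 hF
  obtain ⟨p, hp⟩ := hG
  obtain ⟨i, hi⟩ := exists_section p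
    ((Representation.IsIrreducible.surjective_or_eq_zero p).resolve_right hp)
  refine ⟨fun y => p (Finsupp.single y 1), fun z => i (ψ z.1) z.2, f, fun g y => ?_,
    fun g z => ?_, ?_⟩
  · rw [← p.isIntertwining, permRep_single]
  · beta_reduce
    rw [Prod.smul_fst, Prod.smul_snd, hψ, i.isIntertwining, permRep_smul_apply]
  · have hsum : kernelSum (fun y => p (Finsupp.single y 1)) f (fun z => i (ψ z.1) z.2) = ψ f := by
      conv_rhs => rw [← hi (ψ f), ← Finsupp.univ_sum_single (i (ψ f)), map_sum]
      simp only [kernelSum_apply, ← map_smul, Finsupp.smul_single, smul_eq_mul, mul_one]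
    rwa [hsum]

theorem exists_common_subquotient (hρ : ρ.IsIrreducible) [Finite (F.obj.obj M)]
    [Finite (G.obj.obj M)] (hF : HasNonzeroHom F ρ) (hG : HasNonzeroHom G ρ) :
    ∃ Q : LinFun A Ms, IsSubquotient Q F ∧ IsSubquotient Q G ∧ HasNonzeroHom Q ρ := by
  have := Fintype.ofFinite (G.obj.obj M)
  have : Finite (End M) := ‹Finite (M ⟶ M)›
  obtain ⟨p, h, f, hp, hh, hne⟩ := exists_kernelSum_ne_zero hρ hF hG
  have hunits (u : (End M)ˣ) (z : F.obj.obj M × G.obj.obj M) : h (u • z) = h z := by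
    obtain ⟨g, hg⟩ := exists_autHom_eq u
    rw [← hh g z, Units.smul_def, ← hg]
    rfl
  obtain ⟨⟨f₀, g₀⟩, hz⟩ :=
    exists_kernelSum_indicator_ne_zero (mem_cyclicIndicatorSpan_of_units_smul_eq hunits) hne
  exact ⟨(ker F.obj f₀ ⊔ ker G.obj g₀).linFun, isSubquotient_linFun le_sup_left,
    isSubquotient_linFun le_sup_right, hasNonzeroHom_sup_ker hp hz⟩

theorem IsTypical.nonempty_iso_of_isTypical (hF : IsTypical F ρ) (hG : IsTypical G ρ) :
    Nonempty (F ≅ G) := by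
  have := hF.finite M
  have := hG.finite M
  obtain ⟨Q, hQF, hQG, hQ⟩ := exists_common_subquotient hF.1 hF.2.1 hG.2.1
  obtain ⟨e⟩ := hF.nonempty_iso hQF hQ
  obtain ⟨e'⟩ := hG.nonempty_iso hQG hQ
  exact ⟨e.symm.trans e'⟩

theorem hasNonzeroHom_iff_embeds (hρ : ρ.IsIrreducible) : HasNonzeroHom F ρ ↔ Embeds ρ F := by
  constructor
  · rintro ⟨p, hp⟩
    obtain ⟨i, hi⟩ := exists_section p
      ((Representation.IsIrreducible.surjective_or_eq_zero p).resolve_right hp)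
    exact ⟨i, Function.LeftInverse.injective hi⟩
  · rintro ⟨i, hi⟩
    obtain ⟨p, hp⟩ := exists_retraction i hi
    have := nontrivial_of_isIrreducible hρ
    obtain ⟨v, hv⟩ := exists_ne (0 : V)
    refine ⟨p, ?_⟩
    rintro rfl
    exact hv (hp v).symm

end Typical

theorem eq_of_le_of_iSupIndep {α ι : Type*} [CompleteLattice α] [IsModularLattice α]
    {U U' : ι → α} (hle : ∀ i, U' i ≤ U i) (hU : iSupIndep U) (hU' : ⨆ i, U' i = ⊤) : U' = U := by
  funext i
  have hdisj : U i ⊓ ⨆ (j) (_ : j ≠ i), U' j ≤ ⊥ :=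
    (inf_le_inf_left _ (iSup₂_mono fun j _ => hle j)).trans (hU i).le_bot
  have htop : U' i ⊔ ⨆ (j) (_ : j ≠ i), U' j = ⊤ := by
    rw [← hU', iSup_split_single U' i]
  exact eq_of_le_of_inf_le_of_le_sup (hle i) (hdisj.trans bot_le) (htop ▸ le_top)

section SemisimpleModules

variable {S V : Type*} [Ring S] [AddCommGroup V] [Module S V] [IsSemisimpleModule S V]

theorem iSupIndep_sSup_of_isSimpleModule {ι : Type*} {s : ι → Set (Submodule S V)}
    (hsimple : ∀ i, ∀ N ∈ s i, IsSimpleModule S N)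
    (hs : ∀ i j, ∀ N ∈ s i, ∀ N' ∈ s j, Nonempty (N ≃ₗ[S] N') → i = j) :
    iSupIndep fun i => sSup (s i) := by
  intro i
  rw [disjoint_iff]
  by_contra hne
  obtain ⟨N, hN, hle⟩ := (eq_bot_or_exists_atom_le _).resolve_left hne
  have : IsSimpleModule S N := isSimpleModule_iff_isAtom.2 hN
  have (m : s i) : IsSimpleModule S m := hsimple i m m.2
  have (m : ⋃ (j) (_ : j ≠ i), s j) : IsSimpleModule S m := by
    obtain ⟨j, -, hj⟩ := Set.mem_iUnion₂.1 m.2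
    exact hsimple j m hj
  have hle' : N ≤ sSup (⋃ (j) (_ : j ≠ i), s j) := by
    simpa only [sSup_iUnion] using hle.trans inf_le_right
  obtain ⟨N₁, hN₁, ⟨e₁⟩⟩ := N.linearEquiv_of_le_sSup _ (hle.trans inf_le_left)
  obtain ⟨N₂, hN₂, ⟨e₂⟩⟩ := N.linearEquiv_of_le_sSup _ hle'
  obtain ⟨j, hj, hN₂⟩ := Set.mem_iUnion₂.1 hN₂
  exact hj (hs i j N₁ hN₁ N₂ hN₂ ⟨e₁.symm.trans e₂⟩).symm

variable (S V) in
theorem exists_fin_iSupIndep_isSimpleModule [Module.Finite S V] :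
    ∃ (n : ℕ) (N : Fin n → Submodule S V),
      iSupIndep N ∧ ⨆ i, N i = ⊤ ∧ ∀ i, IsSimpleModule S (N i) := by
  obtain ⟨s, hs, hs', hsimple⟩ := IsSemisimpleModule.exists_sSupIndep_sSup_simples_eq_top S V
  have hind : iSupIndep ((↑) : s → Submodule S V) := (sSupIndep_iff _).1 hs
  have : Finite s := WellFoundedGT.finite_of_iSupIndep hind fun N =>
    (isSimpleModule_iff_isAtom.1 (hsimple N N.2)).1
  obtain ⟨n, ⟨e⟩⟩ := Finite.exists_equiv_fin s
  refine ⟨n, fun i => e.symm i, hind.comp e.symm.injective, ?_, fun i => hsimple _ (e.symm i).2⟩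
  rw [← hs', sSup_eq_iSup']
  exact e.symm.iSup_comp (g := fun N : s => N.1)

end SemisimpleModules

section Subrepresentations

open Representation
open scoped MonoidAlgebra

variable {K G V : Type*} [Field K] [Group G] [AddCommGroup V] [Module K V]
  {ρ : Representation K G V}

/-- A subrepresentation as a module over the group algebra is the corresponding submodule. -/
def asModuleEquivAsSubmodule (W : Subrepresentation ρ) :
    W.toRepresentation.asModule ≃ₗ[K[G]] W.asSubmodule :=
  LinearEquiv.ofBijective ((IntertwiningMap.equivLinearMapAsModule W.toRepresentation ρ
      ⟨W.toSubmodule.subtype, fun _ => rfl⟩).codRestrict W.asSubmodule fun z => z.2)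
    ⟨fun _ _ h => Subtype.ext (congrArg Subtype.val h), fun z => ⟨⟨z.1, z.2⟩, rfl⟩⟩

/-- The representation on a submodule over the group algebra. -/
abbrev subRep (N : Submodule K[G] ρ.asModule) :
    Representation K G (Subrepresentation.ofSubmodule' N).toSubmodule :=
  (Subrepresentation.ofSubmodule' N).toRepresentation

/-- The module of the representation on a submodule is that submodule. -/
def asModuleSubRepEquiv (N : Submodule K[G] ρ.asModule) : (subRep N).asModule ≃ₗ[K[G]] N :=
  asModuleEquivAsSubmodule (Subrepresentation.ofSubmodule' N)

theorem isIrreducible_subRep_iff (N : Submodule K[G] ρ.asModule) :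
    (subRep N).IsIrreducible ↔ IsSimpleModule K[G] N := by
  rw [irreducible_iff_isSimpleModule_asModule]
  exact (asModuleSubRepEquiv N).isSimpleModule_iff

end Subrepresentations

section Strata

open Representation
open scoped MonoidAlgebra

variable {A : Type u₁} [CommRing A] {R : Type u₂} [Ring R] [Algebra A R]
  {k : ℕ} {Ms : Fin k → ModuleCat.{v} R} {K : Type w} [Field K] {M : AddSpan Ms}
  {V : Type x} [AddCommGroup V] [Module K V] {ρ : Representation K (AutGroup M) V}
  {V' : Type y} [AddCommGroup V'] [Module K V'] {ρ' : Representation K (AutGroup M) V'}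
  {F : LinFun A Ms} {c c' : IsoClass A Ms}

theorem HasNonzeroHom.of_equiv (e : ρ.asModule ≃ₗ[K[AutGroup M]] ρ'.asModule)
    (h : HasNonzeroHom F ρ) : HasNonzeroHom F ρ' := by
  obtain ⟨f, hf⟩ := h
  refine ⟨((IntertwiningMap.equivLinearMapAsModule ρ ρ').symm e.toLinearMap).comp f,
    fun h0 => hf ?_⟩
  ext z
  exact e.injective ((DFunLike.congr_fun h0 _).trans (map_zero e).symm)

theorem IsTypical.of_equiv (e : ρ.asModule ≃ₗ[K[AutGroup M]] ρ'.asModule)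
    (h : IsTypical F ρ) : IsTypical F ρ' := by
  rw [isTypical_iff] at h ⊢
  refine ⟨?_, h.2.1.of_equiv e, fun G hG hGρ => h.2.2 G hG (hGρ.of_equiv e.symm)⟩
  rw [irreducible_iff_isSimpleModule_asModule, ← e.isSimpleModule_iff,
    ← irreducible_iff_isSimpleModule_asModule]
  exact h.1

/-- `ρ` is typical for the functors in the isomorphism class `c`. -/
def IsTypicalClass (c : IsoClass A Ms) (ρ : Representation K (AutGroup M) V) : Prop :=
  ∃ F : LinFun A Ms, (⟦F⟧ : IsoClass A Ms) = c ∧ IsTypical F ρ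

theorem IsTypicalClass.of_equiv (e : ρ.asModule ≃ₗ[K[AutGroup M]] ρ'.asModule)
    (h : IsTypicalClass c ρ) : IsTypicalClass c ρ' := by
  obtain ⟨F, hF, h⟩ := h
  exact ⟨F, hF, h.of_equiv e⟩

theorem IsTypicalClass.isTypical (h : IsTypicalClass (⟦F⟧ : IsoClass A Ms) ρ) :
    IsTypical F ρ := by
  obtain ⟨G, hG, h⟩ := h
  obtain ⟨e⟩ := Quotient.exact hG
  exact h.of_iso e

theorem isDirectSumOf_iff {ι : Type*} {U : ι → Subrepresentation ρ} :
    IsDirectSumOf ρ U ↔ iSupIndep (fun i => (U i).asSubmodule) ∧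
      ⨆ i, (U i).asSubmodule = ⊤ := by
  classical
  rw [← DirectSum.isInternal_submodule_iff_iSupIndep_and_iSup_eq_top]
  unfold IsDirectSumOf
  exact Iff.rfl

variable {N : Submodule K[AutGroup M] ρ.asModule} {N' : Submodule K[AutGroup M] ρ'.asModule}

theorem IsTypicalClass.subRep_of_equiv (e : N ≃ₗ[K[AutGroup M]] N')
    (h : IsTypicalClass c (subRep N)) : IsTypicalClass c (subRep N') :=
  h.of_equiv ((asModuleSubRepEquiv N).trans (e.trans (asModuleSubRepEquiv N').symm))

theorem IsTypicalClass.isSimpleModule (h : IsTypicalClass c (subRep N)) :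
    IsSimpleModule K[AutGroup M] N := by
  obtain ⟨F, -, h⟩ := h
  exact (isIrreducible_subRep_iff N).1 h.1

theorem isTypicalClass_of_le_sSup {s : Set (Submodule K[AutGroup M] ρ.asModule)}
    (hs : ∀ N ∈ s, IsTypicalClass c (subRep N)) [IsSimpleModule K[AutGroup M] N]
    (h : N ≤ sSup s) : IsTypicalClass c (subRep N) := by
  have (m : s) : IsSimpleModule K[AutGroup M] m := (hs m m.2).isSimpleModule
  obtain ⟨N', hN', ⟨e⟩⟩ := N.linearEquiv_of_le_sSup s h
  exact (hs N' hN').subRep_of_equiv e.symm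

variable (N) in
theorem InStratumClass.isTypicalClass (h : InStratumClass c ρ) [IsSimpleModule K[AutGroup M] N] :
    IsTypicalClass c (subRep N) := by
  obtain ⟨F, hF, n, U, hU, hsum⟩ := h
  refine isTypicalClass_of_le_sSup (s := Set.range fun i => (U i).asSubmodule)
    (Set.forall_mem_range.2 fun i => ⟨F, hF, hU i⟩) ?_
  rw [sSup_range, (isDirectSumOf_iff.1 hsum).2]
  exact le_top

variable (ρ) in
/-- The sum of all irreducible subrepresentations that are typical for the class `c`. -/
def typicalPart (c : IsoClass A Ms) : Submodule K[AutGroup M] ρ.asModule :=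
  sSup {N | IsTypicalClass c (subRep N)}

variable [Finite (M ⟶ M)] [NeZero (Nat.card (AutGroup M) : K)]

theorem IsTypicalClass.eq (h : IsTypicalClass c ρ) (h' : IsTypicalClass c' ρ) : c = c' := by
  obtain ⟨F, rfl, h⟩ := h
  obtain ⟨F', rfl, h'⟩ := h'
  exact Quotient.sound (h.nonempty_iso_of_isTypical h')

theorem iSupIndep_typicalPart : iSupIndep (typicalPart ρ : IsoClass A Ms → _) :=
  iSupIndep_sSup_of_isSimpleModule (fun _ _ hN => hN.isSimpleModule)
    fun _ _ _ hN _ hN' ⟨e⟩ => (hN.subRep_of_equiv e).eq hN'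

theorem iSup_typicalPart : ⨆ c : IsoClass A Ms, typicalPart ρ c = ⊤ := by
  rw [eq_top_iff, ← IsSemisimpleModule.sSup_simples_eq_top K[AutGroup M] ρ.asModule]
  refine sSup_le fun N (hN : IsSimpleModule _ N) => ?_
  obtain ⟨F, hF⟩ := exists_isTypical A ((isIrreducible_subRep_iff N).2 hN)
  exact le_iSup_of_le ⟦F⟧ (le_sSup ⟨F, rfl, hF⟩)

theorem inStratumClass_of_forall [FiniteDimensional K V]
    (h : ∀ N : Submodule K[AutGroup M] ρ.asModule,
      IsSimpleModule K[AutGroup M] N → IsTypicalClass c (subRep N)) : InStratumClass c ρ := by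
  have : Module.Finite K ρ.asModule := inferInstanceAs (Module.Finite K V)
  have : Module.Finite K[AutGroup M] ρ.asModule := Module.Finite.of_restrictScalars_finite K _ _
  obtain ⟨n, N, hind, htop, hsimple⟩ :=
    exists_fin_iSupIndep_isSimpleModule K[AutGroup M] ρ.asModule
  induction c using Quotient.ind with | _ F => ?_
  exact ⟨F, rfl, n, fun i => Subrepresentation.ofSubmodule' (N i),
    fun i => (h (N i) (hsimple i)).isTypical, isDirectSumOf_iff.2 ⟨hind, htop⟩⟩

theorem inStratumClass_toRepresentation_iff [FiniteDimensional K V] {W : Subrepresentation ρ} :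
    InStratumClass c W.toRepresentation ↔ W.asSubmodule ≤ typicalPart ρ c := by
  let φ := W.asSubmodule.subtype ∘ₗ (asModuleEquivAsSubmodule W).toLinearMap
  have hφ : Function.Injective φ :=
    W.asSubmodule.subtype_injective.comp (asModuleEquivAsSubmodule W).injective
  have hrange : LinearMap.range φ = W.asSubmodule := by
    rw [LinearMap.range_comp, LinearEquiv.range, Submodule.map_top, Submodule.range_subtype]
  constructor
  · intro h
    rw [← IsSemisimpleModule.sSup_simples_le W.asSubmodule]
    refine sSup_le fun N ⟨hN, hle⟩ => le_sSup ?_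
    let e : N.comap φ ≃ₗ[K[AutGroup M]] N := (Submodule.equivMapOfInjective φ hφ _).trans
      (LinearEquiv.ofEq _ _ (Submodule.map_comap_eq_self (hrange ▸ hle)))
    have : IsSimpleModule K[AutGroup M] (N.comap φ) := IsSimpleModule.congr e
    exact (h.isTypicalClass (N.comap φ)).subRep_of_equiv e
  · refine fun h => inStratumClass_of_forall fun N hN => ?_
    let e := Submodule.equivMapOfInjective φ hφ N
    have : IsSimpleModule K[AutGroup M] (N.map φ) := IsSimpleModule.congr (N := N) e.symm
    have hle : N.map φ ≤ typicalPart ρ c := (LinearMap.map_le_range.trans hrange.le).trans h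
    exact (isTypicalClass_of_le_sSup (fun _ hN' => hN') hle).subRep_of_equiv e.symm

theorem existsUnique_decomposition [FiniteDimensional K V] :
    ∃! U : IsoClass A Ms → Subrepresentation ρ,
      (∀ c, InStratumClass c (U c).toRepresentation) ∧ IsDirectSumOf ρ U := by
  refine ⟨fun c => Subrepresentation.ofSubmodule' (typicalPart ρ c), ⟨fun c => ?_, ?_⟩, ?_⟩
  · exact inStratumClass_toRepresentation_iff.2 le_rfl
  · exact isDirectSumOf_iff.2 ⟨iSupIndep_typicalPart, iSup_typicalPart⟩
  · rintro U ⟨hU, hsum⟩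
    have heq := eq_of_le_of_iSupIndep (fun c => inStratumClass_toRepresentation_iff.1 (hU c))
      iSupIndep_typicalPart (isDirectSumOf_iff.1 hsum).2
    funext c
    exact Subrepresentation.subrepresentationSubmoduleOrderIso.injective (congrFun heq c)

theorem intertwiningMap_eq_zero (hcc : c ≠ c') (h : InStratumClass c ρ)
    (h' : InStratumClass c' ρ') (f : ρ.IntertwiningMap ρ') : f = 0 := by
  set φ := IntertwiningMap.equivLinearMapAsModule ρ ρ' f with hφ
  suffices hker : LinearMap.ker φ = ⊤ by
    rwa [LinearMap.ker_eq_top, hφ, LinearEquiv.map_eq_zero_iff] at hker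
  rw [eq_top_iff, ← IsSemisimpleModule.sSup_simples_eq_top K[AutGroup M] ρ.asModule]
  refine sSup_le fun N (hN : IsSimpleModule _ N) => ?_
  rcases LinearMap.injective_or_eq_zero (φ.domRestrict N) with hinj | hzero
  · let e := LinearEquiv.ofInjective _ hinj
    have := IsSimpleModule.congr (N := N) e.symm
    exact (hcc ((h.isTypicalClass N).eq ((h'.isTypicalClass _).subRep_of_equiv e.symm))).elim
  · exact fun z hz => LinearMap.congr_fun hzero ⟨z, hz⟩

end Strata

end FunctorMorphing

end

open FunctorMorphing in
theorem theoremA_general {A : Type u₁} [CommRing A] {R : Type u₂} [Ring R] [Algebra A R]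
    {k : ℕ} (Ms : Fin k → ModuleCat.{v} R) (M : AddSpan Ms) [∀ X : AddSpan Ms, Finite (M ⟶ X)]
    {K : Type w} [Field K] [NeZero (Nat.card (AutGroup M) : K)] :
    (∀ {V : Type x} [AddCommGroup V] [Module K V] (ρ : Representation K (AutGroup M) V),
      ρ.IsIrreducible → ∃ F : LinFun A Ms, IsFiniteValued F ∧
        ∀ G : LinFun A Ms, IsTypical G ρ ↔ Nonempty (G ≅ F)) ∧
    (∀ {V : Type x} [AddCommGroup V] [Module K V] (ρ : Representation K (AutGroup M) V),
      ρ.IsIrreducible → ∀ F : LinFun A Ms, (IsTypical F ρ ↔ Embeds ρ F ∧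
        ∀ G : LinFun A Ms, IsProperSubquotient G F → ¬ Embeds ρ G)) ∧
    (∀ {V : Type x} [AddCommGroup V] [Module K V] [FiniteDimensional K V]
      (ρ : Representation K (AutGroup M) V), ∃! U : IsoClass A Ms → Subrepresentation ρ,
        (∀ c, InStratumClass c (U c).toRepresentation) ∧ IsDirectSumOf ρ U) ∧
    (∀ {V V' : Type x} [AddCommGroup V] [Module K V] [AddCommGroup V'] [Module K V']
      (ρ : Representation K (AutGroup M) V) (ρ' : Representation K (AutGroup M) V')
      (c c' : IsoClass A Ms), c ≠ c' → InStratumClass c ρ → InStratumClass c' ρ' →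
        ∀ f : ρ.IntertwiningMap ρ', f = 0) := by
  refine ⟨fun ρ hρ => ?_, fun ρ hρ F => ?_, fun ρ => existsUnique_decomposition,
    fun ρ ρ' c c' hcc h h' f => intertwiningMap_eq_zero hcc h h' f⟩
  · obtain ⟨F, hF⟩ := exists_isTypical A hρ
    exact ⟨F, fun X => hF.finite X, fun G =>
      ⟨fun hG => hG.nonempty_iso_of_isTypical hF, fun ⟨e⟩ => hF.of_iso e.symm⟩⟩
  · simp only [isTypical_iff, ← hasNonzeroHom_iff_embeds hρ, hρ, true_and]

open FunctorMorphing in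
/-- Let `𝔬` be a complete discrete valuation ring with finite residue field, `R` a finite
`𝔬/𝔭^ℓ`-algebra, `𝒞 = ⟨M₁, …, M_k⟩` for finite indecomposable `R`-modules `Mᵢ`, `M ∈ 𝒞`, and `K` an
algebraically closed field of characteristic zero. -/
theorem theoremA {𝔬 : Type u₁} [CommRing 𝔬] [IsDomain 𝔬] [IsDiscreteValuationRing 𝔬]
    [IsAdicComplete (IsLocalRing.maximalIdeal 𝔬) 𝔬] [Finite (IsLocalRing.ResidueField 𝔬)] (ℓ : ℕ)
    {R : Type u₂} [Ring R] [Algebra (𝔬 ⧸ IsLocalRing.maximalIdeal 𝔬 ^ ℓ) R] [Finite R]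
    {k : ℕ} (Ms : Fin k → ModuleCat.{v} R) (hfin : ∀ i, Finite (Ms i))
    (hind : ∀ i, CategoryTheory.Indecomposable (Ms i))
    (M : AddSpan Ms) {K : Type w} [Field K] [IsAlgClosed K] [CharZero K] :
    -- Every irreducible `V` is `F`-typical for a (finite-valued) functor `F`, unique up to
    -- isomorphism.
    (∀ {V : Type x} [AddCommGroup V] [Module K V] (ρ : Representation K (AutGroup M) V),
      ρ.IsIrreducible →
        ∃ F : LinFun (𝔬 ⧸ IsLocalRing.maximalIdeal 𝔬 ^ ℓ) Ms, IsFiniteValued F ∧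
          ∀ G : LinFun (𝔬 ⧸ IsLocalRing.maximalIdeal 𝔬 ^ ℓ) Ms,
            IsTypical G ρ ↔ Nonempty (G ≅ F)) ∧
    -- Typicality can equally be tested on subrepresentations.
    (∀ {V : Type x} [AddCommGroup V] [Module K V] (ρ : Representation K (AutGroup M) V),
      ρ.IsIrreducible → ∀ F : LinFun (𝔬 ⧸ IsLocalRing.maximalIdeal 𝔬 ^ ℓ) Ms,
        (IsTypical F ρ ↔ Embeds ρ F ∧
          ∀ G : LinFun (𝔬 ⧸ IsLocalRing.maximalIdeal 𝔬 ^ ℓ) Ms,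
            IsProperSubquotient G F → ¬ Embeds ρ G)) ∧
    -- `Rep(Aut_R(M)) = ⨁_F Rep(Aut_R(M))_F`: every finite-dimensional representation has a unique
    -- decomposition into pieces in the strata, and there are no non-zero morphisms between
    -- different strata.
    (∀ {V : Type x} [AddCommGroup V] [Module K V] [FiniteDimensional K V]
      (ρ : Representation K (AutGroup M) V),
        ∃! U : IsoClass (𝔬 ⧸ IsLocalRing.maximalIdeal 𝔬 ^ ℓ) Ms → Subrepresentation ρ,
          (∀ c, InStratumClass c (U c).toRepresentation) ∧ IsDirectSumOf ρ U) ∧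
    (∀ {V V' : Type x} [AddCommGroup V] [Module K V] [AddCommGroup V'] [Module K V']
      (ρ : Representation K (AutGroup M) V) (ρ' : Representation K (AutGroup M) V')
      (c c' : IsoClass (𝔬 ⧸ IsLocalRing.maximalIdeal 𝔬 ^ ℓ) Ms), c ≠ c' →
        InStratumClass c ρ → InStratumClass c' ρ' →
          ∀ f : ρ.IntertwiningMap ρ', f = 0) := by
  have hhom := finite_hom hfin M
  have : NeZero (Nat.card (AutGroup M) : K) := ⟨Nat.cast_ne_zero.2 Nat.card_pos.ne'⟩
  exact theoremA_general Ms M
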